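/- Let $\mathbf A\in\mathbb C^{q\times N}$, $\mathbf F\in\mathbb C^{r\times N}$, $\sigma_{\mathrm B}>0$, $\sigma_{\mathrm E}\ge 0$, $\widetilde\sigma_{\mathrm B}\ge 0$. A random word $\mathbf x\in\mathbb C^N$ of law $p_{\mathbf x}$ is sent through the channels $\mathbf y=\mathbf A\mathbf x+\boldsymbol\omega_{\mathrm B}$ and $\mathbf z=\mathbf F\mathbf x+\boldsymbol\omega_{\mathrm E}$, with independent circularly symmetric Gaussian noises $\boldsymbol\omega_{\mathrm B}\sim\mathcal{CN}(0,\sigma_{\mathrm B}^2\mathbf I)$ and $\boldsymbol\omega_{\mathrm E}\sim\mathcal{CN}(0,\sigma_{\mathrm E}^2\mathbf I)$. An attack is a conditional law $p_{\mathbf v|\mathbf z}$ of a vector $\mathbf v=\mathbf v_0+\widetilde{\boldsymbol\omega}_{\mathrm B}\in\mathbb C^q$, where $\mathbf v_0$ is produced from $\mathbf z$ by an arbitrary conditional law $p_{\mathbf v_0|\mathbf z}$ and $\widetilde{\boldsymbol\omega}_{\mathrm B}\sim\mathcal{CN}(0,\widetilde\sigma_{\mathrm B}^2\mathbf I)$ is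 independent noise; $\mathbf v$ and $\mathbf x$ are conditionally independent given $\mathbf z$. Put $$f(p_{\mathbf x},p_{\mathbf v|\mathbf z})=\mathbb D(p_{\mathbf{xv}}\,\|\,p_{\mathbf{xy}})\in[0,\infty],$$ where $\mathbb D$ is the Kullback--Leibler divergence, and let $\mathcal C$ be the class of attacks $p_{\mathbf v|\mathbf z}\sim\mathcal{CN}(\mathbf G\mathbf z,\ \mathbf C\mathbf C^H+\widetilde\sigma_{\mathrm B}^2\mathbf I)$ with $\mathbf G\in\mathbb C^{q\times r}$, $\mathbf C\in\mathbb C^{q\times q}$ arbitrary. An attack is called optimal against $p_{\mathbf x}$ if it minimizes $f(p_{\mathbf x},\cdot)$ over all attacks. Let $\mathbf K_{\mathbf x}\in\mathbb C^{N\times N}$ be positive semidefinite, $p_{\mathbf x}^\star=\mathcal{CN}(0,\mathbf K_{\mathbf x})$, and let $p_{\mathbf x}$ be any probability law on $\mathbb C^N$ with finite second moments and the same covariance matrix, $\mathbb E[\mathbf x\mathbf x^H]=\mathbf K_{\mathbf x}$. Then $$f(p_{\mathbf x},p_{\mathbf v|\mathbf z})=f(p_{\mathbf x}^\star,p_{\mathbf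 v|\mathbf z})\qquad\text{for all }p_{\mathbf v|\mathbf z}\in\mathcal C .$$ Suppose moreover that the matrix $$\mathbf Q=\sigma_{\mathrm B}^2\mathbf I-\sigma_{\mathrm E}^2\,\mathbf A\mathbf K_{\mathbf x}\mathbf F^H\big[(\mathbf F\mathbf K_{\mathbf x}\mathbf F^H)^\dagger\big]^2\mathbf F\mathbf K_{\mathbf x}\mathbf A^H-\widetilde\sigma_{\mathrm B}^2\mathbf I$$ ($\dagger$ denoting the Moore--Penrose pseudoinverse) is positive semidefinite. Let $\mathbf G^\star=\mathbf A\mathbf K_{\mathbf x}\mathbf F^H(\mathbf F\mathbf K_{\mathbf x}\mathbf F^H)^\dagger$, let $\mathbf C^\star\in\mathbb C^{q\times q}$ be any matrix with $\mathbf C^\star\mathbf C^{\star H}=\mathbf Q$, and let $p_{\mathbf v|\mathbf z}^\star\sim\mathcal{CN}(\mathbf G^\star\mathbf z,\ \mathbf C^\star\mathbf C^{\star H}+\widetilde\sigma_{\mathrm B}^2\mathbf I)$, which belongs to $\mathcal C$. Then $p^\star_{\mathbf v|\mathbf z}$ is an optimal attack against $p_{\mathbf x}^\star$, and for every optimal attack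 $p^o_{\mathbf v|\mathbf z}$ against $p_{\mathbf x}$, $$f(p_{\mathbf x},p^o_{\mathbf v|\mathbf z})\le f(p_{\mathbf x},p^\star_{\mathbf v|\mathbf z})=f(p_{\mathbf x}^\star,p^\star_{\mathbf v|\mathbf z})\le f(p_{\mathbf x}^\star,p^o_{\mathbf v|\mathbf z}).$$ -/

import Mathlib

open MeasureTheory ProbabilityTheory
open scoped ENNReal Matrix MatrixOrder ComplexOrder

namespace Spoofing

noncomputable section

/-- The standard circularly symmetric complex Gaussian law on `ℂ`: independent real and imaginary
parts, each centred of variance `1 / 2`. -/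
def stdComplexGaussian : Measure ℂ :=
  ((gaussianReal 0 (1 / 2)).prod (gaussianReal 0 (1 / 2))).map
    (fun t : ℝ × ℝ => (t.1 : ℂ) + (t.2 : ℂ) * Complex.I)

instance : IsProbabilityMeasure stdComplexGaussian :=
  Measure.isProbabilityMeasure_map (by fun_prop)

/-- The law `CN(0, I)` on `ℂ^k`: independent standard complex Gaussian coordinates. -/
def stdComplexGaussianVec (k : ℕ) : Measure (Fin k → ℂ) :=
  Measure.pi (fun _ => stdComplexGaussian)

instance (k : ℕ) : IsProbabilityMeasure (stdComplexGaussianVec k) := by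
  unfold stdComplexGaussianVec; infer_instance

/-- The proper (circularly symmetric) complex Gaussian law on `ℂ^k` with mean `m` and covariance
matrix `S`, for `S` positive semidefinite: the law of `m + S^{1/2} w` with `w ∼ CN(0, I)`. -/
def complexGaussian {k : ℕ} (m : Fin k → ℂ) (S : Matrix (Fin k) (Fin k) ℂ) :
    Measure (Fin k → ℂ) :=
  (stdComplexGaussianVec k).map (fun w => m + CFC.sqrt S *ᵥ w)

theorem measurable_mulVec {k l : ℕ} (M : Matrix (Fin k) (Fin l) ℂ) :
    Measurable (fun w : Fin l → ℂ => M *ᵥ w) := by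
  refine measurable_pi_lambda _ fun i => ?_
  simp only [Matrix.mulVec, dotProduct]
  fun_prop

instance {k : ℕ} (m : Fin k → ℂ) (S : Matrix (Fin k) (Fin k) ℂ) :
    IsProbabilityMeasure (complexGaussian m S) :=
  Measure.isProbabilityMeasure_map ((measurable_mulVec _).const_add m).aemeasurable

/-- The linear Gaussian channel `u ↦ CN(M u, S)`, that is `M u` plus independent noise of law
`CN(0, S)`, as a Markov kernel. -/
def linearGaussianKernel {k l : ℕ} (M : Matrix (Fin k) (Fin l) ℂ) (S : Matrix (Fin k) (Fin k) ℂ) :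
    Kernel (Fin l → ℂ) (Fin k → ℂ) where
  toFun u := complexGaussian (M *ᵥ u) S
  measurable' := by
    have hf : Measurable (fun t : (Fin l → ℂ) × (Fin k → ℂ) => M *ᵥ t.1 + CFC.sqrt S *ᵥ t.2) :=
      ((measurable_mulVec M).comp measurable_fst).add
        ((measurable_mulVec _).comp measurable_snd)
    refine Measure.measurable_of_measurable_coe _ fun s hs => ?_
    have h : (fun u : Fin l → ℂ => complexGaussian (M *ᵥ u) S s) = fun u =>
        stdComplexGaussianVec k (Prod.mk u ⁻¹'
          ((fun t : (Fin l → ℂ) × (Fin k → ℂ) => M *ᵥ t.1 + CFC.sqrt S *ᵥ t.2) ⁻¹' s)) := by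
      funext u
      rw [complexGaussian, Measure.map_apply ((measurable_mulVec _).const_add _) hs]
      rfl
    rw [h]
    exact measurable_measure_prodMk_left (hf hs)

instance {k l : ℕ} (M : Matrix (Fin k) (Fin l) ℂ) (S : Matrix (Fin k) (Fin k) ℂ) :
    IsMarkovKernel (linearGaussianKernel M S) :=
  ⟨fun u => by change IsProbabilityMeasure (complexGaussian _ _); infer_instance⟩

/-- The white-noise covariance matrix `σ² I`. -/
def whiteCov (k : ℕ) (σ : ℝ) : Matrix (Fin k) (Fin k) ℂ := ((σ ^ 2 : ℝ) : ℂ) • 1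

/-- `μ` has finite second moments and `E[x xᴴ] = K`. -/
def HasCovariance {k : ℕ} (μ : Measure (Fin k → ℂ)) (K : Matrix (Fin k) (Fin k) ℂ) : Prop :=
  (∀ i, MemLp (fun x : Fin k → ℂ => x i) 2 μ) ∧
    ∀ i j, ∫ x, x i * star (x j) ∂μ = K i j

/-- The payoff `f(p_x, p_{v|z}) = D(p_{xv} ‖ p_{xy})`, for the channels `y = A x + ω_B`,
`z = F x + ω_E` with `ω_B ∼ CN(0, σB² I)`, `ω_E ∼ CN(0, σE² I)`. The joint law `p_{xv}` is the one
for which `v` and `x` are conditionally independent given `z`. -/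
def payoff {N r q : ℕ} (A : Matrix (Fin q) (Fin N) ℂ) (F : Matrix (Fin r) (Fin N) ℂ)
    (σB σE : ℝ) (μ : Measure (Fin N → ℂ)) (κ : Kernel (Fin r → ℂ) (Fin q → ℂ)) : ℝ≥0∞ :=
  InformationTheory.klDiv
    (μ.compProd (κ.comp (linearGaussianKernel F (whiteCov r σE))))
    (μ.compProd (linearGaussianKernel A (whiteCov q σB)))

/-- The attack strategies `p_{v|z}`: `v = v₀ + ω` where `v₀` is produced from `z` by an arbitrary
probabilistic strategy `p_{v₀|z}` and `ω ∼ CN(0, σV² I)` is independent receiver noise. -/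
def attacks (r q : ℕ) (σV : ℝ) : Set (Kernel (Fin r → ℂ) (Fin q → ℂ)) :=
  {κ | ∃ η : Kernel (Fin r → ℂ) (Fin q → ℂ), IsMarkovKernel η ∧
    ∀ z, κ z = (η z).conv (complexGaussian 0 (whiteCov q σV))}

/-- The attack `v ∼ CN(G z, C Cᴴ + σV² I)`. -/
def gaussianAttack {r q : ℕ} (σV : ℝ) (G : Matrix (Fin q) (Fin r) ℂ)
    (C : Matrix (Fin q) (Fin q) ℂ) : Kernel (Fin r → ℂ) (Fin q → ℂ) :=
  linearGaussianKernel G (C * Cᴴ + whiteCov q σV)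

/-- The class `𝒞` of linear Gaussian attacks. -/
def classC (r q : ℕ) (σV : ℝ) : Set (Kernel (Fin r → ℂ) (Fin q → ℂ)) :=
  {κ | ∃ G C, κ = gaussianAttack σV G C}

/-- `κ` is an attack that minimises the payoff against the input law `μ` among all attacks. -/
def IsOptimalAttack {N r q : ℕ} (A : Matrix (Fin q) (Fin N) ℂ) (F : Matrix (Fin r) (Fin N) ℂ)
    (σB σE σV : ℝ) (μ : Measure (Fin N → ℂ)) (κ : Kernel (Fin r → ℂ) (Fin q → ℂ)) : Prop :=
  κ ∈ attacks r q σV ∧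
    ∀ κ' ∈ attacks r q σV, payoff A F σB σE μ κ ≤ payoff A F σB σE μ κ'

/-- The Moore-Penrose pseudoinverse `M† = (Mᴴ M)† Mᴴ`, where the pseudoinverse of the Hermitian
matrix `Mᴴ M` inverts its nonzero eigenvalues and keeps the zero ones (`0⁻¹ = 0`). -/
def pinv {k l : ℕ} (M : Matrix (Fin k) (Fin l) ℂ) : Matrix (Fin l) (Fin k) ℂ :=
  cfc (fun t : ℝ => t⁻¹) (Mᴴ * M) * Mᴴ

/-- `pinv M` satisfies the four Penrose identities, which determine it. -/
theorem pinv_spec {k l : ℕ} (M : Matrix (Fin k) (Fin l) ℂ) :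
    M * pinv M * M = M ∧ pinv M * M * pinv M = pinv M ∧
      (M * pinv M)ᴴ = M * pinv M ∧ (pinv M * M)ᴴ = pinv M * M := by
  set H : Matrix (Fin l) (Fin l) ℂ := Mᴴ * M with hH
  set J : Matrix (Fin l) (Fin l) ℂ := cfc (fun t : ℝ => t⁻¹) H with hJ
  have hp : pinv M = J * Mᴴ := rfl
  have hHs : IsSelfAdjoint H := Matrix.isHermitian_conjTranspose_mul_self M
  have hHh : Hᴴ = H := hHs
  have hc : ∀ g : ℝ → ℝ, ContinuousOn g (spectrum ℝ H) := fun g =>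
    (Matrix.finite_real_spectrum (A := H)).continuousOn g
  have hJs : Jᴴ = J := cfc_predicate (p := IsSelfAdjoint) (fun t : ℝ => t⁻¹) H
  have hid : cfc (fun t : ℝ => t) H = H := cfc_id' ℝ H
  have hJH : J * H = cfc (fun t : ℝ => t⁻¹ * t) H := by
    rw [cfc_mul _ _ H (hc _) (hc _), hid]
  have hHJ : H * J = cfc (fun t : ℝ => t * t⁻¹) H := by
    rw [cfc_mul _ _ H (hc _) (hc _), hid]
  have hcomm : H * J = J * H := by
    rw [hJH, hHJ]; simp only [mul_comm]
  have hHJH : H * (J * H) = H := by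
    rw [hJH]
    conv_lhs => rw [← hid]
    rw [hid]
    nth_rewrite 1 [← hid]
    rw [← cfc_mul _ _ H (hc _) (hc _)]
    conv_rhs => rw [← hid]
    congr 1
    funext t
    by_cases ht : t = 0
    · simp [ht]
    · field_simp
  have hJHJ : J * H * J = J := by
    rw [hJH, hJ, ← cfc_mul _ _ H (hc _) (hc _)]
    congr 1
    funext t
    by_cases ht : t = 0
    · simp [ht]
    · field_simp
  have hMM : pinv M * M = J * H := by rw [hp, Matrix.mul_assoc]
  refine ⟨?_, ?_, ?_, ?_⟩
  · rw [Matrix.mul_assoc, hMM, ← sub_eq_zero, ← Matrix.conjTranspose_mul_self_eq_zero]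
    have h1 : Mᴴ * (M * (J * H) - M) = 0 := by
      rw [Matrix.mul_sub, ← Matrix.mul_assoc, ← hH, hHJH, sub_self]
    rw [Matrix.conjTranspose_sub, Matrix.sub_mul, Matrix.conjTranspose_mul, Matrix.mul_assoc, h1,
      Matrix.mul_zero, sub_zero]
  · rw [hMM, hp, ← Matrix.mul_assoc, hJHJ]
  · rw [hp, Matrix.conjTranspose_mul, Matrix.conjTranspose_mul, Matrix.conjTranspose_conjTranspose,
      hJs, Matrix.mul_assoc]
  · rw [hMM, Matrix.conjTranspose_mul, hJs, hHh, hcomm]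

/-- `G⋆ = A K Fᴴ (F K Fᴴ)†`. -/
def Gstar {N r q : ℕ} (A : Matrix (Fin q) (Fin N) ℂ) (F : Matrix (Fin r) (Fin N) ℂ)
    (K : Matrix (Fin N) (Fin N) ℂ) : Matrix (Fin q) (Fin r) ℂ :=
  A * K * Fᴴ * pinv (F * K * Fᴴ)

/-- The matrix `σB² I - σE² A K Fᴴ ((F K Fᴴ)†)² F K Aᴴ - σV² I`, which the optimal attack takes as
`C⋆ C⋆ᴴ`; a matrix `C⋆` with this property exists iff it is positive semidefinite. -/
def CstarCov {N r q : ℕ} (A : Matrix (Fin q) (Fin N) ℂ) (F : Matrix (Fin r) (Fin N) ℂ)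
    (K : Matrix (Fin N) (Fin N) ℂ) (σB σE σV : ℝ) : Matrix (Fin q) (Fin q) ℂ :=
  whiteCov q σB
    - ((σE ^ 2 : ℝ) : ℂ) • (A * K * Fᴴ * pinv (F * K * Fᴴ) ^ 2 * (F * K * Aᴴ))
    - whiteCov q σV

end

end Spoofing

namespace Spoofing

/-! Substitute `w = (v - GFx)/σB` in both laws. The legitimate law `p_{xy}` becomes the law of `(x,
w + Bx)` with `w ∼ CN(0, I)` independent of `x` and `B = (A - GF)/σB`, which is the product law
tilted by `2 Re⟨Bx, w⟩ - |Bx|²`. A linear Gaussian attack with gain `G` becomes a product of `p_x`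
and a centred Gaussian `P`. The cross term then averages to zero, so the payoff is `D(P ‖ CN(0, I))
+ E|Bx|²`, which sees `p_x` only through `K` (`payoff_linearGaussianKernel`).

For `G⋆` the condition on `C⋆` makes `P = CN(0, I)`, so the payoff is `E|Bx|²`. That no attack does
better against Gaussian input (`ofReal_trace_le_payoff`) follows from a symmetry. The matrix `A -
G⋆F` gives the error in estimating `Ax` linearly from `Fx`, and some reflection `T`
(`exists_reflection`) negates this error, almost surely fixes `Fx`, and preserves `CN(0, K)`. An
attack sees `x` only through a noisy `Fx`, so its transformed joint law is `T`-invariant, while `T`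
turns the reference tilt by `B` into the tilt by `-B`. The divergence to the second tilt is thus at
most that to the first. Their sum is at least `2E|Bx|²`, because the divergence to the untilted
product is nonnegative.

The final chain combines optimality of `po` against `px`, equality of payoffs on the class, and
optimality of the starred attack against Gaussian input. -/

/-! ### Laplace transforms and characteristic functions of complex Gaussian laws. -/

theorem integral_cexp_mul_gaussianReal (a : ℂ) :
    ∫ t : ℝ, Complex.exp (a * t) ∂(gaussianReal 0 (1 / 2)) = Complex.exp (a ^ 2 / 4) := by
  have h := complexMGF_gaussianReal (p := gaussianReal 0 (1 / 2)) (X := id) Measure.map_id a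
  simp only [complexMGF, id_eq] at h
  rw [h]
  congr 1
  push_cast
  ring

/-- The complex Laplace transform of `CN(0, 1)`. -/
theorem integral_cexp_stdComplexGaussian (a b : ℂ) :
    ∫ z : ℂ, Complex.exp (a * z.re + b * z.im) ∂stdComplexGaussian
      = Complex.exp ((a ^ 2 + b ^ 2) / 4) := by
  rw [stdComplexGaussian, integral_map (by fun_prop) (by fun_prop)]
  simp only [Complex.add_re, Complex.ofReal_re, Complex.mul_re, Complex.I_re, mul_zero,
    Complex.ofReal_im, Complex.I_im, mul_one, sub_self, add_zero, Complex.add_im, Complex.mul_im,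
    zero_add, Complex.exp_add]
  rw [integral_prod_mul (fun t : ℝ => Complex.exp (a * t)) (fun t : ℝ => Complex.exp (b * t)),
    integral_cexp_mul_gaussianReal, integral_cexp_mul_gaussianReal, ← Complex.exp_add, add_div]

theorem integral_cexp_stdComplexGaussianVec {k : ℕ} (a b : Fin k → ℂ) :
    ∫ w, Complex.exp (∑ i, (a i * (w i).re + b i * (w i).im)) ∂(stdComplexGaussianVec k)
      = Complex.exp ((∑ i, (a i ^ 2 + b i ^ 2)) / 4) := by
  simp only [Complex.exp_sum, stdComplexGaussianVec]
  rw [integral_fintype_prod_eq_prod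
    (f := fun i (z : ℂ) => Complex.exp (a i * z.re + b i * z.im)), Finset.sum_div, Complex.exp_sum]
  simp only [integral_cexp_stdComplexGaussian]

theorem re_star_dotProduct {k : ℕ} (c w : Fin k → ℂ) :
    (star c ⬝ᵥ w).re = ∑ i, ((c i).re * (w i).re + (c i).im * (w i).im) := by
  simp [dotProduct, Complex.re_sum, Complex.mul_re]

/-- The characteristic function of `CN(0, I)`, tilted by an exponential weight. -/
theorem integral_cexp_mul_exp_stdComplexGaussianVec {k : ℕ} (c b : Fin k → ℂ) :
    ∫ w, Complex.exp ((star c ⬝ᵥ w).re * Complex.I) *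
        Real.exp (2 * (star b ⬝ᵥ w).re - (star b ⬝ᵥ b).re) ∂(stdComplexGaussianVec k)
      = Complex.exp ((star c ⬝ᵥ b).re * Complex.I - (star c ⬝ᵥ c).re / 4) := by
  -- With coefficients `i c + 2b`, a quarter of the square is `-c²/4 + i c b + b²` in each real
  -- coordinate; the normalisation `-|b|²` cancels the last term.
  have h := integral_cexp_stdComplexGaussianVec
    (fun i => (c i).re * Complex.I + 2 * (b i).re) (fun i => (c i).im * Complex.I + 2 * (b i).im)
  have h2 : ∀ w : Fin k → ℂ, Complex.exp ((star c ⬝ᵥ w).re * Complex.I) *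
        Real.exp (2 * (star b ⬝ᵥ w).re - (star b ⬝ᵥ b).re) =
      Complex.exp (-((star b ⬝ᵥ b).re : ℂ)) * Complex.exp (∑ i,
        (((c i).re * Complex.I + 2 * (b i).re) * (w i).re +
          ((c i).im * Complex.I + 2 * (b i).im) * (w i).im)) := by
    intro w
    rw [Complex.ofReal_exp, ← Complex.exp_add, ← Complex.exp_add]
    congr 1
    simp only [re_star_dotProduct, Complex.ofReal_sum, Complex.ofReal_add, Complex.ofReal_mul,
      Complex.ofReal_sub, Finset.sum_mul, Finset.mul_sum, Complex.ofReal_ofNat]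
    have h3 : ∀ u v x y : ℂ, u + v = x → u + (v - y) = -y + x := by rintro u v x y rfl; ring
    refine h3 _ _ _ _ ?_
    rw [← Finset.sum_add_distrib]
    exact Finset.sum_congr rfl fun i _ => by ring
  simp only [h2]
  rw [integral_const_mul, h, ← Complex.exp_add]
  congr 1
  simp only [re_star_dotProduct, Complex.ofReal_sum, Complex.ofReal_add, Complex.ofReal_mul,
      Finset.sum_mul, Finset.sum_div, ← Finset.sum_neg_distrib, ← Finset.sum_add_distrib,
      ← Finset.sum_sub_distrib]
  refine Finset.sum_congr rfl fun i _ => ?_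
  linear_combination (((c i).re : ℂ) ^ 2 / 4 + ((c i).im : ℂ) ^ 2 / 4) * Complex.I_sq

/-- The vector representing a real-linear functional on `ℂ^k` through `w ↦ Re (aᴴ w)`. -/
noncomputable def dualVec {k : ℕ} (L : StrongDual ℝ (Fin k → ℂ)) : Fin k → ℂ :=
  fun i => ⟨L (Pi.single i 1), L (Pi.single i Complex.I)⟩

theorem dual_apply {k : ℕ} (L : StrongDual ℝ (Fin k → ℂ)) (w : Fin k → ℂ) :
    L w = (star (dualVec L) ⬝ᵥ w).re := by
  have hw : w = ∑ i, ((w i).re • (Pi.single i 1 : Fin k → ℂ)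
      + (w i).im • (Pi.single i Complex.I : Fin k → ℂ)) := by
    funext j
    simp only [Finset.sum_apply, Pi.add_apply, Pi.smul_apply, Pi.single_apply, smul_ite, smul_zero,
      Finset.sum_add_distrib, Finset.sum_ite_eq, Finset.mem_univ, if_true]
    apply Complex.ext <;> simp
  conv_lhs => rw [hw]
  simp only [map_sum, map_add, map_smul, smul_eq_mul, re_star_dotProduct, dualVec]
  exact Finset.sum_congr rfl fun i _ => by ring

/-- The functional pulls back along `M` to the vector `Mᴴ *ᵥ dualVec L`, so only `M Mᴴ` survives;
hence different factors of one covariance give the same law. -/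
theorem charFunDual_stdComplexGaussianVec_map {k l : ℕ} (m : Fin k → ℂ)
    (M : Matrix (Fin k) (Fin l) ℂ) (L : StrongDual ℝ (Fin k → ℂ)) :
    charFunDual ((stdComplexGaussianVec l).map (fun w => m + M *ᵥ w)) L =
      Complex.exp (L m * Complex.I - (star (dualVec L) ⬝ᵥ (M * Mᴴ) *ᵥ dualVec L).re / 4) := by
  rw [charFunDual_apply, integral_map ((measurable_mulVec M).const_add m).aemeasurable
    (by fun_prop)]
  have h := integral_cexp_mul_exp_stdComplexGaussianVec (Mᴴ *ᵥ dualVec L) 0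
  have h1 : ∀ w, star (Mᴴ *ᵥ dualVec L) ⬝ᵥ w = star (dualVec L) ⬝ᵥ M *ᵥ w := by
    intro w
    rw [Matrix.star_mulVec, Matrix.conjTranspose_conjTranspose, Matrix.dotProduct_mulVec]
  simp only [star_zero, zero_dotProduct, Complex.zero_re, mul_zero, sub_zero, Real.exp_zero,
    Complex.ofReal_one, mul_one, dotProduct_zero, h1, Matrix.mulVec_mulVec, Matrix.mulVec_zero,
    Complex.ofReal_zero, zero_mul, zero_sub] at h
  simp only [map_add, Complex.ofReal_add, add_mul, Complex.exp_add]
  rw [integral_const_mul, sub_eq_add_neg, Complex.exp_add, ← h]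
  simp only [dual_apply]

/-! ### Affine images, convolutions and compositions of Gaussian channels. -/

theorem sqrt_mul_conjTranspose_sqrt {k : ℕ} {S : Matrix (Fin k) (Fin k) ℂ} (hS : S.PosSemidef) :
    CFC.sqrt S * (CFC.sqrt S)ᴴ = S := by
  have h : (CFC.sqrt S)ᴴ = CFC.sqrt S :=
    (Matrix.nonneg_iff_posSemidef.mp (CFC.sqrt_nonneg S)).isHermitian
  rw [h]
  exact CFC.sqrt_mul_sqrt_self S (Matrix.nonneg_iff_posSemidef.mpr hS)

theorem charFunDual_complexGaussian {k : ℕ} (m : Fin k → ℂ) {S : Matrix (Fin k) (Fin k) ℂ}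
    (hS : S.PosSemidef) (L : StrongDual ℝ (Fin k → ℂ)) :
    charFunDual (complexGaussian m S) L =
      Complex.exp (L m * Complex.I - (star (dualVec L) ⬝ᵥ S *ᵥ dualVec L).re / 4) := by
  rw [complexGaussian, charFunDual_stdComplexGaussianVec_map, sqrt_mul_conjTranspose_sqrt hS]

/-- An affine image of `CN(0, I)` is the complex Gaussian law with the covariance `M Mᴴ`. -/
theorem stdComplexGaussianVec_map {k l : ℕ} (m : Fin k → ℂ) (M : Matrix (Fin k) (Fin l) ℂ)
    {S : Matrix (Fin k) (Fin k) ℂ} (h : M * Mᴴ = S) :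
    (stdComplexGaussianVec l).map (fun w => m + M *ᵥ w) = complexGaussian m S := by
  have : IsProbabilityMeasure ((stdComplexGaussianVec l).map (fun w => m + M *ᵥ w)) :=
    Measure.isProbabilityMeasure_map ((measurable_mulVec M).const_add m).aemeasurable
  refine Measure.ext_of_charFunDual (funext fun L => ?_)
  rw [charFunDual_stdComplexGaussianVec_map, charFunDual_complexGaussian, h]
  rw [← h]
  exact Matrix.posSemidef_self_mul_conjTranspose M

theorem complexGaussian_map {k l : ℕ} (c : Fin k → ℂ) (M : Matrix (Fin k) (Fin l) ℂ)
    (m : Fin l → ℂ) {S : Matrix (Fin l) (Fin l) ℂ} (hS : S.PosSemidef) :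
    (complexGaussian m S).map (fun w => c + M *ᵥ w) =
      complexGaussian (c + M *ᵥ m) (M * S * Mᴴ) := by
  rw [complexGaussian, Measure.map_map ((measurable_mulVec M).const_add c)
    ((measurable_mulVec _).const_add m), ← stdComplexGaussianVec_map (l := l) _ (M * CFC.sqrt S)]
  · congr 1
    funext w
    simp [Matrix.mulVec_add, Matrix.mulVec_mulVec, add_assoc]
  · rw [Matrix.conjTranspose_mul, ← Matrix.mul_assoc, Matrix.mul_assoc M,
      sqrt_mul_conjTranspose_sqrt hS]

theorem complexGaussian_conv {k : ℕ} (m m' : Fin k → ℂ) {S S' : Matrix (Fin k) (Fin k) ℂ}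
    (hS : S.PosSemidef) (hS' : S'.PosSemidef) :
    (complexGaussian m S).conv (complexGaussian m' S') = complexGaussian (m + m') (S + S') := by
  refine Measure.ext_of_charFunDual (funext fun L => ?_)
  rw [charFunDual_conv, charFunDual_complexGaussian _ hS, charFunDual_complexGaussian _ hS',
    charFunDual_complexGaussian _ (hS.add hS'), ← Complex.exp_add]
  congr 1
  simp only [map_add, Matrix.add_mulVec, dotProduct_add, Complex.add_re, Complex.ofReal_add]
  ring

theorem posSemidef_whiteCov (k : ℕ) (σ : ℝ) : (whiteCov k σ).PosSemidef :=
  Matrix.PosSemidef.one.smul (by exact_mod_cast sq_nonneg σ)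

/-- A Gaussian channel followed by a Gaussian channel. -/
theorem linearGaussianKernel_comp {k l n : ℕ} (G : Matrix (Fin n) (Fin k) ℂ)
    {S' : Matrix (Fin n) (Fin n) ℂ} (F : Matrix (Fin k) (Fin l) ℂ) {S : Matrix (Fin k) (Fin k) ℂ}
    (hS : S.PosSemidef) (hS' : S'.PosSemidef) :
    (linearGaussianKernel G S').comp (linearGaussianKernel F S) =
      linearGaussianKernel (G * F) (G * S * Gᴴ + S') := by
  refine Kernel.ext fun u => Measure.ext fun s hs => ?_
  change _ = complexGaussian ((G * F) *ᵥ u) (G * S * Gᴴ + S') s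
  have hm : (complexGaussian (F *ᵥ u) S).map (fun z => G *ᵥ z) =
      complexGaussian ((G * F) *ᵥ u) (G * S * Gᴴ) := by
    have := complexGaussian_map 0 G (F *ᵥ u) hS
    simpa [Matrix.mulVec_mulVec] using this
  have hc := complexGaussian_conv ((G * F) *ᵥ u) 0 (hS.mul_mul_conjTranspose_same G) hS'
  rw [add_zero] at hc
  rw [Kernel.comp_apply' _ _ _ hs, ← hc, ← lintegral_indicator_one hs,
    Measure.lintegral_conv (measurable_one.indicator hs), ← hm,
    lintegral_map _ (measurable_mulVec G)]
  · refine lintegral_congr fun z => ?_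
    change complexGaussian (G *ᵥ z) S' s = _
    have hz : complexGaussian (G *ᵥ z) S' = (complexGaussian 0 S').map (fun w => G *ᵥ z + w) := by
      have := complexGaussian_map (G *ᵥ z) 1 0 hS'
      simpa using this.symm
    rw [hz, ← lintegral_indicator_one hs, lintegral_map (measurable_one.indicator hs)
      (measurable_const_add _)]
  · exact Measurable.lintegral_prod_right' (f := fun t : (Fin n → ℂ) × (Fin n → ℂ) =>
      s.indicator (1 : (Fin n → ℂ) → ℝ≥0∞) (t.1 + t.2))
      ((measurable_one.indicator hs).comp (measurable_fst.add measurable_snd))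

/-! ### Shifts of `CN(0, I)` as exponential tilts. -/

/-- The logarithm of the density of `CN(b, I)` relative to `CN(0, I)`. -/
noncomputable def shiftExponent {k : ℕ} (b w : Fin k → ℂ) : ℝ :=
  2 * (star b ⬝ᵥ w).re - (star b ⬝ᵥ b).re

theorem continuous_shiftExponent {k : ℕ} :
    Continuous (fun t : (Fin k → ℂ) × (Fin k → ℂ) => shiftExponent t.1 t.2) := by
  simp only [shiftExponent, re_star_dotProduct]
  fun_prop

theorem measurable_shiftExponent {k : ℕ} :
    Measurable (fun t : (Fin k → ℂ) × (Fin k → ℂ) => shiftExponent t.1 t.2) :=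
  continuous_shiftExponent.measurable

theorem integral_exp_shiftExponent {k : ℕ} (b : Fin k → ℂ) :
    ∫ w, Real.exp (shiftExponent b w) ∂(stdComplexGaussianVec k) = 1 := by
  have h := integral_cexp_mul_exp_stdComplexGaussianVec 0 b
  simp only [star_zero, zero_dotProduct, Complex.zero_re, Complex.ofReal_zero, zero_mul,
    Complex.exp_zero, one_mul, zero_div, sub_zero] at h
  rw [integral_complex_ofReal] at h
  exact_mod_cast h

theorem integrable_exp_shiftExponent {k : ℕ} (b : Fin k → ℂ) :
    Integrable (fun w => Real.exp (shiftExponent b w)) (stdComplexGaussianVec k) := by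
  -- A non-integrable function has Bochner integral `0`, but this integral is `1`.
  by_contra h
  have := integral_exp_shiftExponent b
  rw [integral_undef h] at this
  exact zero_ne_one this

/-- The shift formula for `CN(0, I)`. -/
theorem stdComplexGaussianVec_map_add {k : ℕ} (b : Fin k → ℂ) :
    (stdComplexGaussianVec k).map (fun w => w + b) =
      (stdComplexGaussianVec k).tilted (shiftExponent b) := by
  have : IsProbabilityMeasure ((stdComplexGaussianVec k).map (fun w => w + b)) :=
    Measure.isProbabilityMeasure_map (by fun_prop)
  refine Measure.ext_of_charFunDual (funext fun L => ?_)
  have h1 := charFunDual_stdComplexGaussianVec_map b (1 : Matrix (Fin k) (Fin k) ℂ) L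
  simp only [Matrix.one_mulVec, Matrix.conjTranspose_one, mul_one, add_comm b] at h1
  rw [h1, charFunDual_apply, integral_tilted, integral_exp_shiftExponent, dual_apply L b,
    ← integral_cexp_mul_exp_stdComplexGaussianVec]
  refine integral_congr_ae (Filter.Eventually.of_forall fun w => ?_)
  simp only [div_one, Complex.real_smul, dual_apply L w, shiftExponent, mul_comm]

variable {α : Type*} [MeasurableSpace α]

theorem measurable_shiftExponent_prod {k : ℕ} {f : α → Fin k → ℂ} (hf : Measurable f) :
    Measurable (fun p : α × (Fin k → ℂ) => shiftExponent (f p.1) p.2) := by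
  simp only [shiftExponent, re_star_dotProduct]
  fun_prop

theorem lintegral_exp_shiftExponent_prod {k : ℕ} (μ : Measure α) [IsProbabilityMeasure μ]
    {f : α → Fin k → ℂ} (hf : Measurable f) :
    ∫⁻ p, ENNReal.ofReal (Real.exp (shiftExponent (f p.1) p.2))
      ∂(μ.prod (stdComplexGaussianVec k)) = 1 := by
  have hm : Measurable (fun p : α × (Fin k → ℂ) =>
      ENNReal.ofReal (Real.exp (shiftExponent (f p.1) p.2))) :=
    (Real.measurable_exp.comp (measurable_shiftExponent_prod hf)).ennreal_ofReal
  rw [lintegral_prod _ hm.aemeasurable]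
  have h : ∀ x, ∫⁻ w, ENNReal.ofReal (Real.exp (shiftExponent (f x) w))
      ∂(stdComplexGaussianVec k) = 1 := fun x => by
    rw [← ofReal_integral_eq_lintegral_ofReal (integrable_exp_shiftExponent _)
      (Filter.Eventually.of_forall fun _ => (Real.exp_pos _).le), integral_exp_shiftExponent,
      ENNReal.ofReal_one]
  simp [h]

theorem integrable_exp_shiftExponent_prod {k : ℕ} (μ : Measure α) [IsProbabilityMeasure μ]
    {f : α → Fin k → ℂ} (hf : Measurable f) :
    Integrable (fun p : α × (Fin k → ℂ) => Real.exp (shiftExponent (f p.1) p.2))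
      (μ.prod (stdComplexGaussianVec k)) := by
  have hm : Measurable (fun p : α × (Fin k → ℂ) => Real.exp (shiftExponent (f p.1) p.2)) :=
    Real.measurable_exp.comp (measurable_shiftExponent_prod hf)
  refine (lintegral_ofReal_ne_top_iff_integrable hm.aestronglyMeasurable
    (Filter.Eventually.of_forall fun _ => (Real.exp_pos _).le)).mp ?_
  rw [lintegral_exp_shiftExponent_prod μ hf]
  exact ENNReal.one_ne_top

theorem integral_exp_shiftExponent_prod {k : ℕ} (μ : Measure α) [IsProbabilityMeasure μ]
    {f : α → Fin k → ℂ} (hf : Measurable f) :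
    ∫ p, Real.exp (shiftExponent (f p.1) p.2) ∂(μ.prod (stdComplexGaussianVec k)) = 1 := by
  have hi := integrable_exp_shiftExponent_prod μ hf
  rw [integral_eq_lintegral_of_nonneg_ae (Filter.Eventually.of_forall fun _ => (Real.exp_pos _).le)
    hi.aestronglyMeasurable, lintegral_exp_shiftExponent_prod μ hf, ENNReal.toReal_one]

/-- The shift formula applied in each fibre over `x`. It presents an additive Gaussian channel as a
tilt of a product law. -/
theorem prod_stdComplexGaussianVec_map_shear {k : ℕ} (μ : Measure α) [IsProbabilityMeasure μ]
    {f : α → Fin k → ℂ} (hf : Measurable f) :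
    (μ.prod (stdComplexGaussianVec k)).map (fun p => (p.1, p.2 + f p.1)) =
      (μ.prod (stdComplexGaussianVec k)).tilted (fun p => shiftExponent (f p.1) p.2) := by
  have hs : Measurable (fun p : α × (Fin k → ℂ) => (p.1, p.2 + f p.1)) :=
    measurable_fst.prodMk (measurable_snd.add (hf.comp measurable_fst))
  have hm : Measurable (fun p : α × (Fin k → ℂ) =>
      ENNReal.ofReal (Real.exp (shiftExponent (f p.1) p.2))) :=
    (Real.measurable_exp.comp (measurable_shiftExponent_prod hf)).ennreal_ofReal
  ext s hS
  rw [Measure.map_apply hs hS, Measure.prod_apply (hs hS), tilted_apply' _ _ hS,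
    integral_exp_shiftExponent_prod μ hf]
  simp only [div_one]
  rw [← lintegral_indicator hS, lintegral_prod _ (hm.indicator hS).aemeasurable]
  refine lintegral_congr fun x => ?_
  have hx : MeasurableSet (Prod.mk x ⁻¹' s) := measurable_prodMk_left hS
  have h1 : Prod.mk x ⁻¹' ((fun p : α × (Fin k → ℂ) => (p.1, p.2 + f p.1)) ⁻¹' s) =
      (fun w => w + f x) ⁻¹' (Prod.mk x ⁻¹' s) := rfl
  rw [h1, ← Measure.map_apply (by fun_prop) hx, stdComplexGaussianVec_map_add,
    tilted_apply' _ _ hx, integral_exp_shiftExponent, ← lintegral_indicator hx]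
  simp only [div_one]
  rfl

/-! ### Divergence relative to tilted reference laws. -/

open InformationTheory

/-- Equal total masses cancel the mass correction in `klDiv`; the second conjunct is Gibbs'
inequality. -/
theorem klDiv_of_prob {P ν : Measure α} [IsProbabilityMeasure P] [IsProbabilityMeasure ν]
    (h1 : P ≪ ν) (h2 : Integrable (llr P ν) P) :
    klDiv P ν = ENNReal.ofReal (∫ x, llr P ν x ∂P) ∧ 0 ≤ ∫ x, llr P ν x ∂P := by
  have h := integral_llr_add_sub_measure_univ_nonneg h1 h2
  rw [klDiv_of_ac_of_integrable h1 h2]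
  simp only [probReal_univ, add_sub_cancel_right] at h ⊢
  exact ⟨trivial, h⟩

theorem llr_tilted_right_of_integral_eq_one {P ν : Measure α} [IsProbabilityMeasure P]
    [IsProbabilityMeasure ν] {g : α → ℝ} (h1 : ∫ x, Real.exp (g x) ∂ν = 1) (hPν : P ≪ ν) :
    llr P (ν.tilted g) =ᵐ[P] fun x => llr P ν x - g x := by
  have hg : Integrable (fun x => Real.exp (g x)) ν := by
    by_contra h
    rw [integral_undef h] at h1
    exact zero_ne_one h1
  filter_upwards [llr_tilted_right hPν hg] with x hx
  rw [hx, h1, Real.log_one]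
  ring

theorem absolutelyContinuous_tilted_iff {P ν : Measure α} [IsProbabilityMeasure ν] {g : α → ℝ}
    (h1 : ∫ x, Real.exp (g x) ∂ν = 1) : P ≪ ν.tilted g ↔ P ≪ ν := by
  have hg : Integrable (fun x => Real.exp (g x)) ν := by
    by_contra h
    rw [integral_undef h] at h1
    exact zero_ne_one h1
  exact ⟨fun h => h.trans (tilted_absolutelyContinuous ν g),
    fun h => h.trans (absolutelyContinuous_tilted hg)⟩

theorem isProbabilityMeasure_tilted_of_integral_eq_one {ν : Measure α} [IsProbabilityMeasure ν]
    {g : α → ℝ} (h1 : ∫ x, Real.exp (g x) ∂ν = 1) : IsProbabilityMeasure (ν.tilted g) := by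
  refine isProbabilityMeasure_tilted ?_
  by_contra h
  rw [integral_undef h] at h1
  exact zero_ne_one h1

/-- Tilting the reference law by an exponent of nonpositive mean increases the divergence by minus
that mean. -/
theorem klDiv_tilted_right {P ν : Measure α} [IsProbabilityMeasure P]
    [IsProbabilityMeasure ν] {g : α → ℝ} (h1 : ∫ x, Real.exp (g x) ∂ν = 1) (hg : Integrable g P)
    (h0 : ∫ x, g x ∂P ≤ 0) :
    klDiv P (ν.tilted g) = klDiv P ν + ENNReal.ofReal (-∫ x, g x ∂P) := by
  have := isProbabilityMeasure_tilted_of_integral_eq_one h1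
  by_cases hPν : P ≪ ν
  swap
  · rw [klDiv_of_not_ac hPν, klDiv_of_not_ac (by rwa [absolutelyContinuous_tilted_iff h1]),
      top_add]
  have hl := llr_tilted_right_of_integral_eq_one h1 hPν
  by_cases hi : Integrable (llr P ν) P
  · have hi' : Integrable (llr P (ν.tilted g)) P := by
      rw [integrable_congr hl]; exact hi.sub hg
    obtain ⟨e, hn⟩ := klDiv_of_prob hPν hi
    -- Both summands are nonnegative, by Gibbs and by `h0`, so `ENNReal.ofReal` is additive here.
    rw [e, (klDiv_of_prob ((absolutelyContinuous_tilted_iff h1).mpr hPν) hi').1,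
      integral_congr_ae hl, integral_sub hi hg, ← ENNReal.ofReal_add hn (by linarith)]
    rfl
  · have hi' : ¬ Integrable (llr P (ν.tilted g)) P := by
      rw [integrable_congr hl]
      intro h
      refine hi ((h.add hg).congr (Filter.Eventually.of_forall fun x => ?_))
      simp
    rw [klDiv_of_not_integrable hi, klDiv_of_not_integrable hi', top_add]

/-- The divergences from a law to two tilts of a reference law add up to at least minus the mean
of the sum of the exponents. -/
theorem ofReal_le_klDiv_tilted_add_klDiv_tilted {P ν : Measure α} [IsProbabilityMeasure P]
    [IsProbabilityMeasure ν] {g g' : α → ℝ} (h1 : ∫ x, Real.exp (g x) ∂ν = 1)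
    (h1' : ∫ x, Real.exp (g' x) ∂ν = 1) (hg : Integrable (fun x => g x + g' x) P) :
    ENNReal.ofReal (-∫ x, (g x + g' x) ∂P) ≤ klDiv P (ν.tilted g) + klDiv P (ν.tilted g') := by
  have := isProbabilityMeasure_tilted_of_integral_eq_one h1
  have := isProbabilityMeasure_tilted_of_integral_eq_one h1'
  by_cases ht : klDiv P (ν.tilted g) = ∞
  · simp [ht]
  by_cases ht' : klDiv P (ν.tilted g') = ∞
  · simp [ht']
  obtain ⟨hac, hi⟩ := klDiv_ne_top_iff.mp ht
  obtain ⟨hac', hi'⟩ := klDiv_ne_top_iff.mp ht'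
  have hPν := (absolutelyContinuous_tilted_iff h1).mp hac
  have hs : (fun x => llr P (ν.tilted g) x + llr P (ν.tilted g') x) =ᵐ[P]
      fun x => 2 * llr P ν x - (g x + g' x) := by
    filter_upwards [llr_tilted_right_of_integral_eq_one h1 hPν,
      llr_tilted_right_of_integral_eq_one h1' hPν] with x hx hx'
    rw [hx, hx']
    ring
  -- Only `g + g'` is assumed integrable, so the ratio to `ν` is controlled through the sum of the
  -- two tilted ratios.
  have hν : Integrable (llr P ν) P := by
    have h2 : Integrable (fun x => 2 * llr P ν x) P := by
      refine ((((hi.add hi').congr hs).add hg)).congr (Filter.Eventually.of_forall fun x => ?_)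
      simp
    refine (h2.const_mul (1 / 2)).congr (Filter.Eventually.of_forall fun x => ?_)
    simp
  obtain ⟨e, hn⟩ := klDiv_of_prob hac hi
  obtain ⟨e', hn'⟩ := klDiv_of_prob hac' hi'
  rw [e, e', ← ENNReal.ofReal_add hn hn']
  refine ENNReal.ofReal_le_ofReal ?_
  rw [← integral_add hi hi', integral_congr_ae hs, integral_sub (hν.const_mul 2) hg,
    integral_const_mul]
  linarith [(klDiv_of_prob hPν hν).2]

variable {β : Type*} [MeasurableSpace β]

/-- Data processing along `e` and along its inverse. -/
theorem klDiv_map_measurableEquiv (P ν : Measure α) [IsFiniteMeasure P] [IsFiniteMeasure ν]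
    (e : α ≃ᵐ β) : klDiv (P.map e) (ν.map e) = klDiv P ν := by
  refine le_antisymm (klDiv_map_le P ν e.measurable) ?_
  have h := klDiv_map_le (P.map e) (ν.map e) e.symm.measurable
  simpa using h

theorem klDiv_prod_left (μ : Measure β) [IsProbabilityMeasure μ] (P ν : Measure α)
    [IsProbabilityMeasure P] [IsProbabilityMeasure ν] :
    klDiv (μ.prod P) (μ.prod ν) = klDiv P ν := by
  rw [← klDiv_compProd_left P ν (Kernel.const α μ), Measure.compProd_const, Measure.compProd_const,
    ← klDiv_map_measurableEquiv (P.prod μ) (ν.prod μ) MeasurableEquiv.prodComm]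
  congr 1 <;> exact (Measure.prod_swap).symm

/-! ### Second moments and the mean of the tilt exponent. -/

theorem measurable_star_apply {k : ℕ} (i : Fin k) :
    Measurable (fun w : Fin k → ℂ => star (w i)) :=
  continuous_star.measurable.comp (measurable_pi_apply i)

theorem memLp_stdComplexGaussian : MemLp (fun z : ℂ => z) 2 stdComplexGaussian := by
  rw [stdComplexGaussian, memLp_map_measure_iff (by fun_prop) (by fun_prop)]
  have h : MemLp (fun t : ℝ => (t : ℂ)) 2 (gaussianReal 0 (1 / 2)) :=
    (memLp_id_gaussianReal 2).ofReal
  exact (h.comp_fst _).add ((h.comp_snd _).mul_const Complex.I)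

theorem integral_stdComplexGaussian : ∫ z : ℂ, z ∂stdComplexGaussian = 0 := by
  have h : Integrable (fun t : ℝ => (t : ℂ)) (gaussianReal 0 (1 / 2)) :=
    ((memLp_id_gaussianReal 1).integrable le_rfl).ofReal
  rw [stdComplexGaussian, integral_map (by fun_prop) (by fun_prop),
    integral_add (h.comp_fst _) ((h.comp_snd _).mul_const Complex.I), integral_mul_const,
    integral_fun_fst (fun t : ℝ => (t : ℂ)), integral_fun_snd (fun t : ℝ => (t : ℂ)),
    integral_complex_ofReal]
  simp

theorem integral_sq_gaussianReal : ∫ t : ℝ, t ^ 2 ∂(gaussianReal 0 (1 / 2)) = 1 / 2 := by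
  have h := variance_fun_id_gaussianReal (μ := 0) (v := 1 / 2)
  rw [variance_of_integral_eq_zero (by fun_prop) (by simp)] at h
  simpa using h

theorem integral_mul_star_stdComplexGaussian :
    ∫ z : ℂ, z * star z ∂stdComplexGaussian = 1 := by
  have h : Integrable (fun t : ℝ => t ^ 2) (gaussianReal 0 (1 / 2)) :=
    (memLp_id_gaussianReal 2).integrable_sq
  have e : ∀ t : ℝ × ℝ, ((t.1 : ℂ) + t.2 * Complex.I) * star ((t.1 : ℂ) + t.2 * Complex.I)
      = ((t.1 ^ 2 + t.2 ^ 2 : ℝ) : ℂ) := fun t => by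
    rw [Complex.star_def, Complex.mul_conj]
    simp [Complex.normSq_apply, sq]
  rw [stdComplexGaussian, integral_map (by fun_prop) (by fun_prop)]
  simp only [e]
  rw [integral_complex_ofReal, integral_add (h.comp_fst _) (h.comp_snd _),
    integral_fun_fst (fun t : ℝ => t ^ 2), integral_fun_snd (fun t : ℝ => t ^ 2)]
  simp only [probReal_univ, integral_sq_gaussianReal]
  norm_num

theorem memLp_stdComplexGaussianVec {k : ℕ} (i : Fin k) :
    MemLp (fun w : Fin k → ℂ => w i) 2 (stdComplexGaussianVec k) :=
  memLp_stdComplexGaussian.comp_measurePreserving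
    (measurePreserving_eval (fun _ : Fin k => stdComplexGaussian) i)

theorem integral_stdComplexGaussianVec {k : ℕ} (i : Fin k) :
    ∫ w, w i ∂(stdComplexGaussianVec k) = 0 := by
  have h := measurePreserving_eval (fun _ : Fin k => stdComplexGaussian) i
  rw [← integral_stdComplexGaussian, ← h.map_eq,
    integral_map (measurable_pi_apply i).aemeasurable (by fun_prop)]
  rfl

theorem integral_mul_star_stdComplexGaussianVec {k : ℕ} (i j : Fin k) :
    ∫ w, w i * star (w j) ∂(stdComplexGaussianVec k) = (1 : Matrix (Fin k) (Fin k) ℂ) i j := by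
  by_cases hij : i = j
  · subst hij
    have h := measurePreserving_eval (fun _ : Fin k => stdComplexGaussian) i
    have hm : Measurable (fun z : ℂ => z * star z) := measurable_id.mul continuous_star.measurable
    rw [Matrix.one_apply_eq, ← integral_mul_star_stdComplexGaussian, ← h.map_eq,
      integral_map (measurable_pi_apply i).aemeasurable hm.aestronglyMeasurable]
    rfl
  · rw [Matrix.one_apply_ne hij]
    have hI : iIndepFun (fun (i : Fin k) (w : Fin k → ℂ) => w i) (stdComplexGaussianVec k) :=
      iIndepFun_pi (μ := fun _ : Fin k => stdComplexGaussian) (X := fun _ z => z)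
        (fun _ => aemeasurable_id)
    have hJ := (hI.indepFun hij).comp (φ := fun z => z) (ψ := fun z => star z)
      measurable_id (by fun_prop)
    have := hJ.integral_mul_eq_mul_integral (measurable_pi_apply i).aestronglyMeasurable
      (measurable_star_apply j).aestronglyMeasurable
    simp only [Pi.mul_apply, Function.comp_apply, integral_stdComplexGaussianVec, zero_mul] at this
    exact this

theorem HasCovariance.integrable {k : ℕ} {μ : Measure (Fin k → ℂ)} {K : Matrix (Fin k) (Fin k) ℂ}
    (h : HasCovariance μ K) (i j : Fin k) : Integrable (fun x => x i * star (x j)) μ :=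
  (h.1 i).integrable_mul (h.1 j).star

/-- Covariance matrices transform by congruence under linear maps. -/
theorem HasCovariance.map {k l : ℕ} {μ : Measure (Fin l → ℂ)} {K : Matrix (Fin l) (Fin l) ℂ}
    (h : HasCovariance μ K) (M : Matrix (Fin k) (Fin l) ℂ) :
    HasCovariance (μ.map (fun x => M *ᵥ x)) (M * K * Mᴴ) := by
  refine ⟨fun i => ?_, fun i j => ?_⟩
  · rw [memLp_map_measure_iff (measurable_pi_apply i).aestronglyMeasurable
      (measurable_mulVec M).aemeasurable]
    simp only [Function.comp_def, Matrix.mulVec, dotProduct]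
    exact memLp_finsetSum _ fun a _ => (h.1 a).const_mul _
  · rw [integral_map (measurable_mulVec M).aemeasurable (by fun_prop)]
    have e : ∀ x, (M *ᵥ x) i * star ((M *ᵥ x) j) =
        ∑ b, ∑ a, M i a * star (M j b) * (x a * star (x b)) := fun x => by
      simp only [Matrix.mulVec, dotProduct, star_sum, star_mul', Finset.sum_mul_sum]
      rw [Finset.sum_comm]
      exact Finset.sum_congr rfl fun b _ => Finset.sum_congr rfl fun a _ => by ring
    simp only [e]
    rw [integral_finsetSum _ fun b _ => integrable_finsetSum _ fun a _ =>
      (h.integrable a b).const_mul _]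
    simp only [Matrix.mul_apply, Finset.sum_mul, Matrix.conjTranspose_apply]
    refine Finset.sum_congr rfl fun b _ => ?_
    rw [integral_finsetSum _ fun a _ => (h.integrable a b).const_mul _]
    refine Finset.sum_congr rfl fun a _ => ?_
    rw [integral_const_mul, h.2]
    ring

theorem hasCovariance_stdComplexGaussianVec (k : ℕ) : HasCovariance (stdComplexGaussianVec k) 1 :=
  ⟨memLp_stdComplexGaussianVec, integral_mul_star_stdComplexGaussianVec⟩

theorem hasCovariance_complexGaussian {k : ℕ} {S : Matrix (Fin k) (Fin k) ℂ}
    (hS : S.PosSemidef) : HasCovariance (complexGaussian 0 S) S := by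
  have h := (hasCovariance_stdComplexGaussianVec k).map (CFC.sqrt S)
  rw [mul_one, sqrt_mul_conjTranspose_sqrt hS] at h
  simpa [complexGaussian] using h

theorem HasCovariance.integrable_dotProduct {k : ℕ} {μ : Measure (Fin k → ℂ)}
    {K : Matrix (Fin k) (Fin k) ℂ} (h : HasCovariance μ K) :
    Integrable (fun x => (star x ⬝ᵥ x).re) μ := by
  have h1 : Integrable (fun x => star x ⬝ᵥ x) μ := integrable_finsetSum _ fun i _ => by
    exact (h.integrable i i).congr (Filter.Eventually.of_forall fun x => mul_comm _ _)
  exact h1.re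

theorem HasCovariance.integral_dotProduct {k : ℕ} {μ : Measure (Fin k → ℂ)}
    {K : Matrix (Fin k) (Fin k) ℂ} (h : HasCovariance μ K) :
    ∫ x, (star x ⬝ᵥ x).re ∂μ = K.trace.re := by
  have h1 : ∀ x : Fin k → ℂ, star x ⬝ᵥ x = ∑ i, x i * star (x i) := fun x => by
    simp only [dotProduct, Pi.star_apply, mul_comm]
  simp only [h1]
  have h2 : ∫ x, (∑ i, x i * star (x i)).re ∂μ = (∫ x, ∑ i, x i * star (x i) ∂μ).re :=
    integral_re (integrable_finsetSum Finset.univ fun i _ => h.integrable i i)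
  rw [h2, integral_finsetSum _ fun i _ => h.integrable i i]
  simp only [h.2, Matrix.trace, Matrix.diag_apply]

theorem HasCovariance.integrable_dotProduct_mulVec {k l : ℕ} {μ : Measure (Fin l → ℂ)}
    {K : Matrix (Fin l) (Fin l) ℂ} (h : HasCovariance μ K) (M : Matrix (Fin k) (Fin l) ℂ) :
    Integrable (fun x => (star (M *ᵥ x) ⬝ᵥ M *ᵥ x).re) μ := by
  have := (h.map M).integrable_dotProduct
  rwa [integrable_map_measure (by simp only [re_star_dotProduct]; fun_prop)
    (measurable_mulVec M).aemeasurable] at this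

theorem HasCovariance.integral_dotProduct_mulVec {k l : ℕ} {μ : Measure (Fin l → ℂ)}
    {K : Matrix (Fin l) (Fin l) ℂ} (h : HasCovariance μ K) (M : Matrix (Fin k) (Fin l) ℂ) :
    ∫ x, (star (M *ᵥ x) ⬝ᵥ M *ᵥ x).re ∂μ = (M * K * Mᴴ).trace.re := by
  rw [← (h.map M).integral_dotProduct, integral_map (measurable_mulVec M).aemeasurable
    (by simp only [re_star_dotProduct]; fun_prop)]

theorem trace_mul_mul_conjTranspose_nonneg {k l : ℕ} {K : Matrix (Fin l) (Fin l) ℂ}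
    (hK : K.PosSemidef) (M : Matrix (Fin k) (Fin l) ℂ) : 0 ≤ (M * K * Mᴴ).trace.re :=
  (Complex.le_def.mp (hK.mul_mul_conjTranspose_same M).trace_nonneg).1

/-- The mean of the exponent under a product law with centred second factor. -/
theorem integral_shiftExponent_prod {k l : ℕ} {μ : Measure (Fin l → ℂ)} [IsProbabilityMeasure μ]
    {K : Matrix (Fin l) (Fin l) ℂ} (h : HasCovariance μ K) (B : Matrix (Fin k) (Fin l) ℂ)
    (S : Matrix (Fin k) (Fin k) ℂ) :
    Integrable (fun p : (Fin l → ℂ) × (Fin k → ℂ) => shiftExponent (B *ᵥ p.1) p.2)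
      (μ.prod ((stdComplexGaussianVec k).map (fun w => S *ᵥ w))) ∧
    ∫ p, shiftExponent (B *ᵥ p.1) p.2
      ∂(μ.prod ((stdComplexGaussianVec k).map (fun w => S *ᵥ w))) = -(B * K * Bᴴ).trace.re := by
  have hP : IsProbabilityMeasure ((stdComplexGaussianVec k).map (fun w => S *ᵥ w)) :=
    Measure.isProbabilityMeasure_map (measurable_mulVec S).aemeasurable
  set P := (stdComplexGaussianVec k).map (fun w => S *ᵥ w) with hPdef
  have hcov := (hasCovariance_stdComplexGaussianVec k).map S
  rw [← hPdef] at hcov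
  have h0 : ∀ i, ∫ w, w i ∂P = 0 := fun i => by
    rw [hPdef, integral_map (measurable_mulVec S).aemeasurable
      (measurable_pi_apply i).aestronglyMeasurable]
    simp only [Matrix.mulVec, dotProduct]
    rw [integral_finsetSum _ fun a _ =>
      ((memLp_stdComplexGaussianVec a).integrable (by norm_num)).const_mul _]
    simp [integral_const_mul, integral_stdComplexGaussianVec]
  have hB := h.map B
  have hBi : ∀ i, Integrable (fun x => star ((B *ᵥ x) i)) μ := fun i => by
    have : Integrable (fun x => star (x i)) (μ.map (fun x => B *ᵥ x)) :=
      (hB.1 i).star.integrable (by norm_num)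
    rwa [integrable_map_measure (measurable_star_apply i).aestronglyMeasurable
      (measurable_mulVec B).aemeasurable] at this
  have hi : ∀ i, Integrable (fun p : (Fin l → ℂ) × (Fin k → ℂ) => star ((B *ᵥ p.1) i) * p.2 i)
      (μ.prod P) := fun i => (hBi i).mul_prod ((hcov.1 i).integrable (by norm_num))
  have hs : Integrable (fun p : (Fin l → ℂ) × (Fin k → ℂ) => star (B *ᵥ p.1) ⬝ᵥ p.2) (μ.prod P) :=
    integrable_finsetSum _ fun i _ => hi i
  -- The cross term vanishes because the second factor is centred; `μ` itself may have a nonzero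
  -- mean.
  have hs0 : ∫ p : (Fin l → ℂ) × (Fin k → ℂ), (star (B *ᵥ p.1) ⬝ᵥ p.2).re ∂(μ.prod P) = 0 := by
    have h2 : ∫ p : (Fin l → ℂ) × (Fin k → ℂ), (star (B *ᵥ p.1) ⬝ᵥ p.2).re ∂(μ.prod P) =
        (∫ p : (Fin l → ℂ) × (Fin k → ℂ), star (B *ᵥ p.1) ⬝ᵥ p.2 ∂(μ.prod P)).re := integral_re hs
    rw [h2]
    simp only [dotProduct, Pi.star_apply]
    rw [integral_finsetSum _ fun i _ => hi i]
    have : ∀ i, ∫ p : (Fin l → ℂ) × (Fin k → ℂ), star ((B *ᵥ p.1) i) * p.2 i ∂(μ.prod P) = 0 :=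
      fun i => by
        rw [integral_prod_mul (fun x => star ((B *ᵥ x) i)) (fun w : Fin k → ℂ => w i), h0, mul_zero]
    simp only [this, Finset.sum_const_zero, Complex.zero_re]
  have hq := (h.integrable_dotProduct_mulVec B).comp_fst P
  simp only [shiftExponent]
  have hs' : Integrable (fun p : (Fin l → ℂ) × (Fin k → ℂ) => 2 * (star (B *ᵥ p.1) ⬝ᵥ p.2).re)
      (μ.prod P) := (hs.re).const_mul 2
  refine ⟨hs'.sub hq, ?_⟩
  rw [integral_sub hs' hq, integral_const_mul, hs0,
    integral_fun_fst (fun x => (star (B *ᵥ x) ⬝ᵥ B *ᵥ x).re), h.integral_dotProduct_mulVec]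
  simp

/-! ### The payoff after a change of variables. -/

theorem compProd_linearGaussianKernel {k l : ℕ} (μ : Measure (Fin l → ℂ)) [IsProbabilityMeasure μ]
    (M : Matrix (Fin k) (Fin l) ℂ) (S : Matrix (Fin k) (Fin k) ℂ) :
    μ.compProd (linearGaussianKernel M S) =
      (μ.prod (stdComplexGaussianVec k)).map
        (fun p => (p.1, M *ᵥ p.1 + CFC.sqrt S *ᵥ p.2)) := by
  have hm : Measurable (fun p : (Fin l → ℂ) × (Fin k → ℂ) =>
      (p.1, M *ᵥ p.1 + CFC.sqrt S *ᵥ p.2)) :=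
    measurable_fst.prodMk (((measurable_mulVec M).comp measurable_fst).add
      ((measurable_mulVec _).comp measurable_snd))
  ext s hs
  rw [Measure.compProd_apply hs, Measure.map_apply hm hs, Measure.prod_apply (hm hs)]
  refine lintegral_congr fun x => ?_
  change complexGaussian (M *ᵥ x) S _ = _
  rw [complexGaussian, Measure.map_apply ((measurable_mulVec _).const_add _)
    (measurable_prodMk_left hs)]
  rfl

theorem sqrt_whiteCov (k : ℕ) {σ : ℝ} (hσ : 0 ≤ σ) :
    CFC.sqrt (whiteCov k σ) = (σ : ℂ) • (1 : Matrix (Fin k) (Fin k) ℂ) := by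
  refine CFC.sqrt_unique ?_ (Matrix.nonneg_iff_posSemidef.mpr
    (Matrix.PosSemidef.one.smul (by exact_mod_cast hσ)))
  rw [whiteCov, smul_mul_smul_comm, mul_one]
  push_cast
  rw [sq]

/-- The invertible affine change of variables `(x, w) ↦ (x, M x + σ w)`. -/
noncomputable def channelEquiv {k l : ℕ} (M : Matrix (Fin k) (Fin l) ℂ) {σ : ℝ} (hσ : 0 < σ) :
    (Fin l → ℂ) × (Fin k → ℂ) ≃ᵐ (Fin l → ℂ) × (Fin k → ℂ) where
  toFun p := (p.1, M *ᵥ p.1 + (σ : ℂ) • p.2)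
  invFun p := (p.1, (σ : ℂ)⁻¹ • (p.2 - M *ᵥ p.1))
  left_inv p := by
    have h : (σ : ℂ) ≠ 0 := by exact_mod_cast hσ.ne'
    refine Prod.ext rfl ?_
    simp only [add_sub_cancel_left, inv_smul_smul₀ h]
  right_inv p := by
    have h : (σ : ℂ) ≠ 0 := by exact_mod_cast hσ.ne'
    refine Prod.ext rfl ?_
    simp only [smul_inv_smul₀ h, add_sub_cancel]
  measurable_toFun := by
    have h : Measurable (fun p : (Fin l → ℂ) × (Fin k → ℂ) => (σ : ℂ) • p.2) :=
      measurable_snd.const_smul (σ : ℂ)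
    exact measurable_fst.prodMk (((measurable_mulVec M).comp measurable_fst).add h)
  measurable_invFun := by
    have h : Measurable (fun p : (Fin l → ℂ) × (Fin k → ℂ) => p.2 - M *ᵥ p.1) :=
      measurable_snd.sub ((measurable_mulVec M).comp measurable_fst)
    exact measurable_fst.prodMk (h.const_smul (σ : ℂ)⁻¹)

theorem channelEquiv_symm_apply {k l : ℕ} (M : Matrix (Fin k) (Fin l) ℂ) {σ : ℝ} (hσ : 0 < σ)
    (p : (Fin l → ℂ) × (Fin k → ℂ)) :
    (channelEquiv M hσ).symm p = (p.1, (σ : ℂ)⁻¹ • (p.2 - M *ᵥ p.1)) := rfl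

variable {N r q : ℕ} {A : Matrix (Fin q) (Fin N) ℂ} {F : Matrix (Fin r) (Fin N) ℂ} {σB σE σV : ℝ}
  {μ : Measure (Fin N → ℂ)} [IsProbabilityMeasure μ] {K : Matrix (Fin N) (Fin N) ℂ}

/-- The payoff after the change of variables, with a tilted product law as reference. -/
theorem payoff_eq_klDiv_tilted (hσB : 0 < σB) (κ : Kernel (Fin r → ℂ) (Fin q → ℂ))
    [IsMarkovKernel κ] (M : Matrix (Fin q) (Fin N) ℂ) :
    payoff A F σB σE μ κ =
      klDiv ((μ.compProd (κ.comp (linearGaussianKernel F (whiteCov r σE)))).map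
          (channelEquiv M hσB).symm)
        ((μ.prod (stdComplexGaussianVec q)).tilted
          (fun p => shiftExponent (((σB : ℂ)⁻¹ • (A - M)) *ᵥ p.1) p.2)) := by
  have h0 : (σB : ℂ) ≠ 0 := by exact_mod_cast hσB.ne'
  have hm : Measurable (fun p : (Fin N → ℂ) × (Fin q → ℂ) =>
      (p.1, A *ᵥ p.1 + CFC.sqrt (whiteCov q σB) *ᵥ p.2)) :=
    measurable_fst.prodMk (((measurable_mulVec A).comp measurable_fst).add
      ((measurable_mulVec _).comp measurable_snd))
  -- The inverse change of variables sends `(x, A x + σB w)` to `(x, w + σB⁻¹ (A - M) x)`, a shear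
  -- of the product law. The matrix `M` is free and later becomes `G * F`.
  rw [payoff, ← klDiv_map_measurableEquiv _ _ (channelEquiv M hσB).symm,
    compProd_linearGaussianKernel, Measure.map_map (MeasurableEquiv.measurable _) hm,
    ← prod_stdComplexGaussianVec_map_shear μ (measurable_mulVec ((σB : ℂ)⁻¹ • (A - M)))]
  congr 2
  funext p
  rw [Function.comp_apply, channelEquiv_symm_apply, sqrt_whiteCov q hσB.le]
  refine Prod.ext rfl ?_
  simp only [Matrix.smul_mulVec, Matrix.one_mulVec, Matrix.sub_mulVec, smul_sub, smul_add,
    smul_smul, inv_mul_cancel₀ h0, one_smul]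
  abel

/-- The payoff of a linear Gaussian attack depends on the input law only through its covariance. -/
theorem payoff_linearGaussianKernel (hσB : 0 < σB) (hμ : HasCovariance μ K) (hK : K.PosSemidef)
    (G : Matrix (Fin q) (Fin r) ℂ) {S : Matrix (Fin q) (Fin q) ℂ} (hS : S.PosSemidef) :
    payoff A F σB σE μ (linearGaussianKernel G S) =
      klDiv ((stdComplexGaussianVec q).map
          (fun w => ((σB : ℂ)⁻¹ • CFC.sqrt (G * whiteCov r σE * Gᴴ + S)) *ᵥ w))
        (stdComplexGaussianVec q) +
      ENNReal.ofReal (((σB : ℂ)⁻¹ • (A - G * F)) * K * ((σB : ℂ)⁻¹ • (A - G * F))ᴴ).trace.re := by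
  set S' := G * whiteCov r σE * Gᴴ + S with hS'
  set B := (σB : ℂ)⁻¹ • (A - G * F) with hB
  set P := (stdComplexGaussianVec q).map (fun w => ((σB : ℂ)⁻¹ • CFC.sqrt S') *ᵥ w) with hP
  have hPp : IsProbabilityMeasure P :=
    Measure.isProbabilityMeasure_map (measurable_mulVec _).aemeasurable
  have hm : Measurable (fun p : (Fin N → ℂ) × (Fin q → ℂ) =>
      (p.1, (G * F) *ᵥ p.1 + CFC.sqrt S' *ᵥ p.2)) :=
    measurable_fst.prodMk (((measurable_mulVec _).comp measurable_fst).add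
      ((measurable_mulVec _).comp measurable_snd))
  -- Subtracting `G F x` leaves only noise independent of `x`, whence a product law.
  have hlaw : (μ.compProd ((linearGaussianKernel G S).comp
      (linearGaussianKernel F (whiteCov r σE)))).map (channelEquiv (G * F) hσB).symm =
      μ.prod P := by
    rw [linearGaussianKernel_comp G F (posSemidef_whiteCov r σE) hS, ← hS',
      compProd_linearGaussianKernel, Measure.map_map (MeasurableEquiv.measurable _) hm]
    have h := Measure.map_prod_map μ (stdComplexGaussianVec q) measurable_id
      (measurable_mulVec ((σB : ℂ)⁻¹ • CFC.sqrt S'))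
    rw [Measure.map_id] at h
    rw [hP, h]
    congr 1
    funext p
    rw [Function.comp_apply, channelEquiv_symm_apply]
    refine Prod.ext rfl ?_
    simp [Matrix.smul_mulVec]
  obtain ⟨hi, he⟩ := integral_shiftExponent_prod hμ B ((σB : ℂ)⁻¹ • CFC.sqrt S')
  rw [← hP] at hi he
  have hn := trace_mul_mul_conjTranspose_nonneg hK B
  rw [payoff_eq_klDiv_tilted hσB _ (G * F), hlaw, ← hB,
    klDiv_tilted_right (integral_exp_shiftExponent_prod μ (measurable_mulVec B)) hi
      (by rw [he]; linarith), he, neg_neg, klDiv_prod_left]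

/-! ### The pseudoinverse and the reflection about the linear estimate. -/

/-- For Hermitian `H` the adjoint of `pinv H` satisfies the Penrose identities too. Evaluating `J H
H J` in two ways gives `H J = J H`, and the two inverses agree. -/
theorem conjTranspose_pinv {k : ℕ} {H : Matrix (Fin k) (Fin k) ℂ} (hH : Hᴴ = H) :
    (pinv H)ᴴ = pinv H := by
  obtain ⟨h1, h2, h3, h4⟩ := pinv_spec H
  set J := pinv H
  have h5 : Jᴴ * H = H * J := by rw [← h3, Matrix.conjTranspose_mul, hH]
  have h6 : H * Jᴴ = J * H := by rw [← h4, Matrix.conjTranspose_mul, hH]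
  have h7 : H * Jᴴ * H = H := by
    have := congrArg Matrix.conjTranspose h1
    simpa only [Matrix.conjTranspose_mul, hH, Matrix.mul_assoc] using this
  have h8 : Jᴴ * H * Jᴴ = Jᴴ := by
    have := congrArg Matrix.conjTranspose h2
    simpa only [Matrix.conjTranspose_mul, hH, Matrix.mul_assoc] using this
  have h9 : J * H * (H * J) = H * J := by
    rw [← h6, ← Matrix.mul_assoc, h7]
  have h10 : J * H * (H * J) = J * H := by
    rw [← h5, Matrix.mul_assoc, ← Matrix.mul_assoc H, h7]
  have h11 : H * J = J * H := h9.symm.trans h10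
  rw [← h8, h5, h11, Matrix.mul_assoc, h6, ← h11, ← Matrix.mul_assoc, h2]

theorem conjTranspose_mul_mul {F : Matrix (Fin r) (Fin N) ℂ} (hK : Kᴴ = K) :
    (F * K * Fᴴ)ᴴ = F * K * Fᴴ := by
  simp only [Matrix.conjTranspose_mul, Matrix.conjTranspose_conjTranspose, hK, Matrix.mul_assoc]

/-- The reflection of the input that fixes the linear estimate from `F x` and negates its error. -/
theorem exists_reflection (A : Matrix (Fin q) (Fin N) ℂ) (F : Matrix (Fin r) (Fin N) ℂ)
    (hK : K.PosSemidef) :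
    ∃ T : Matrix (Fin N) (Fin N) ℂ, T * K * Tᴴ = K ∧ F * T * CFC.sqrt K = F * CFC.sqrt K ∧
      (A - Gstar A F K * F) * T = -(A - Gstar A F K * F) ∧
      Gstar A F K * F * T = Gstar A F K * F := by
  have hKh : Kᴴ = K := hK.isHermitian
  have hJh := conjTranspose_pinv (conjTranspose_mul_mul (F := F) hKh)
  obtain ⟨h1, h2, h3, -⟩ := pinv_spec (F * K * Fᴴ)
  have hG : Gstar A F K = A * K * Fᴴ * pinv (F * K * Fᴴ) := rfl
  set J := pinv (F * K * Fᴴ)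
  -- `W x` is the linear estimate of `x` from `F x`; `W` is idempotent and self-adjoint relative to
  -- `K`.
  set W := K * Fᴴ * J * F with hW
  have hGF : Gstar A F K * F = A * W := by rw [hG, hW]; simp only [Matrix.mul_assoc]
  have hWW : W * W = W := by
    have : W * W = K * Fᴴ * (J * (F * K * Fᴴ) * J) * F := by
      rw [hW]; simp only [Matrix.mul_assoc]
    rw [this, h2]
  have hKW : K * Wᴴ = W * K := by
    rw [hW]
    simp only [Matrix.conjTranspose_mul, Matrix.conjTranspose_conjTranspose, hJh, hKh,
      Matrix.mul_assoc]
  have hWKW : W * K * Wᴴ = W * K := by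
    rw [Matrix.mul_assoc, hKW, ← Matrix.mul_assoc, hWW]
  -- Since `F K Fᴴ` may be singular, `F W = F` is claimed only on the range of `CFC.sqrt K`; it
  -- holds there because `(F W - F) K (F W - F)ᴴ = 0`.
  have hFW : F * W * CFC.sqrt K = F * CFC.sqrt K := by
    have h0 : (F * K * Fᴴ * J * F - F) * K * (F * K * Fᴴ * J * F - F)ᴴ = 0 := by
      have e : (F * K * Fᴴ * J * F - F) * K * (F * K * Fᴴ * J * F - F)ᴴ =
          (F * K * Fᴴ * J * (F * K * Fᴴ) - F * K * Fᴴ) * ((F * K * Fᴴ * J)ᴴ - 1) := by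
        simp only [Matrix.conjTranspose_sub, Matrix.conjTranspose_mul,
          Matrix.conjTranspose_conjTranspose, hKh, hJh, Matrix.sub_mul, Matrix.mul_sub,
          Matrix.mul_assoc, Matrix.mul_one]
      rw [e, h1, sub_self, Matrix.zero_mul]
    have h4 : (F * K * Fᴴ * J * F - F) * CFC.sqrt K = 0 := by
      rw [← Matrix.self_mul_conjTranspose_eq_zero, Matrix.conjTranspose_mul, ← Matrix.mul_assoc,
        Matrix.mul_assoc _ (CFC.sqrt K), sqrt_mul_conjTranspose_sqrt hK, h0]
    rw [Matrix.sub_mul, sub_eq_zero] at h4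
    rw [← h4, hW]
    simp only [Matrix.mul_assoc]
  -- The reflection `2W - 1` is `1` on the range of the idempotent `W` and `-1` on its kernel.
  refine ⟨(2 : ℂ) • W - 1, ?_, ?_, ?_, ?_⟩
  · have h2s : star (2 : ℂ) = 2 := by simp
    simp only [Matrix.conjTranspose_sub, Matrix.conjTranspose_smul, h2s, Matrix.conjTranspose_one,
      Matrix.sub_mul, Matrix.mul_sub, Matrix.smul_mul, Matrix.mul_smul, Matrix.one_mul,
      Matrix.mul_one, hWKW, hKW]
    module
  · simp only [Matrix.mul_sub, Matrix.sub_mul, Matrix.mul_smul, Matrix.smul_mul, Matrix.mul_one,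
      hFW]
    module
  · rw [hGF]
    simp only [Matrix.mul_sub, Matrix.sub_mul, Matrix.mul_smul, Matrix.mul_one,
      Matrix.mul_assoc, hWW]
    module
  · rw [hGF]
    simp only [Matrix.mul_sub, Matrix.mul_smul, Matrix.mul_one, Matrix.mul_assoc, hWW]
    module

/-! ### The lower bound for arbitrary attacks on Gaussian input. -/

/-- A joint law whose second coordinate depends on the first one through `h` only is invariant under
transformations of the first coordinate that preserve its law and `h`. -/
theorem compProd_map_prodMap_of_ae_eq {α β : Type*} [MeasurableSpace α] [MeasurableSpace β]
    {ν : Measure α} [SFinite ν] {τ : Kernel α β} [IsSFiniteKernel τ] {T : α → α}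
    (hT : Measurable T) (hν : ν.map T = ν) (hτ : ∀ᵐ x ∂ν, τ (T x) = τ x) :
    (ν.compProd τ).map (Prod.map T id) = ν.compProd τ := by
  have hm : Measurable (Prod.map T id : α × β → α × β) := hT.prodMap measurable_id
  ext s hs
  rw [Measure.map_apply hm hs, Measure.compProd_apply (hm hs), Measure.compProd_apply hs]
  conv_rhs => rw [← hν, lintegral_map (Kernel.measurable_kernel_prodMk_left hs) hT]
  refine lintegral_congr_ae ?_
  filter_upwards [hτ] with x hx
  rw [hx]
  rfl

/-- No attack does better against Gaussian input than the mean squared estimation error. -/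
theorem ofReal_trace_le_payoff (hσB : 0 < σB) (hK : K.PosSemidef)
    (κ : Kernel (Fin r → ℂ) (Fin q → ℂ)) [IsMarkovKernel κ] :
    ENNReal.ofReal (((σB : ℂ)⁻¹ • (A - Gstar A F K * F)) * K *
        ((σB : ℂ)⁻¹ • (A - Gstar A F K * F))ᴴ).trace.re ≤
      payoff A F σB σE (complexGaussian 0 K) κ := by
  obtain ⟨T, hT1, hT2, hT3, hT4⟩ := exists_reflection A F hK
  set G := Gstar A F K
  set B := (σB : ℂ)⁻¹ • (A - G * F) with hB
  set ν := complexGaussian 0 K with hν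
  have hBT : ∀ x, B *ᵥ (T *ᵥ x) = -(B *ᵥ x) := fun x => by
    rw [Matrix.mulVec_mulVec, hB, Matrix.smul_mul, hT3, smul_neg, Matrix.neg_mulVec]
  have hmT := measurable_mulVec T
  have hνT : ν.map (fun x => T *ᵥ x) = ν := by
    have := complexGaussian_map 0 T 0 hK
    simpa [hT1] using this
  have hTm : Measurable (Prod.map (fun x => T *ᵥ x) id :
      (Fin N → ℂ) × (Fin q → ℂ) → (Fin N → ℂ) × (Fin q → ℂ)) := hmT.prodMap measurable_id
  set τ := κ.comp (linearGaussianKernel F (whiteCov r σE)) with hτ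
  have hae : ∀ᵐ x ∂ν, τ (T *ᵥ x) = τ x := by
    -- Almost sure only: a sample of `ν` lies in the range of `CFC.sqrt K`, where `F T = F`.
    have hF : ∀ᵐ x ∂ν, F *ᵥ (T *ᵥ x) = F *ᵥ x := by
      have hms : MeasurableSet {x : Fin N → ℂ | F *ᵥ (T *ᵥ x) = F *ᵥ x} :=
        measurableSet_eq_fun ((measurable_mulVec F).comp hmT) (measurable_mulVec F)
      rw [hν, complexGaussian, ae_map_iff ((measurable_mulVec _).const_add _).aemeasurable hms]
      refine Filter.Eventually.of_forall fun w => ?_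
      simp only [zero_add, Matrix.mulVec_mulVec, hT2, ← Matrix.mul_assoc]
    filter_upwards [hF] with x hx
    have : linearGaussianKernel F (whiteCov r σE) (T *ᵥ x) =
        linearGaussianKernel F (whiteCov r σE) x := by
      change complexGaussian _ _ = complexGaussian _ _
      rw [hx]
    rw [hτ, Kernel.comp_apply, Kernel.comp_apply, this]
  set P := (ν.compProd τ).map (channelEquiv (G * F) hσB).symm with hP
  have hPp : IsProbabilityMeasure P :=
    Measure.isProbabilityMeasure_map (MeasurableEquiv.measurable _).aemeasurable
  -- The reflection commutes with the change of variables because `G F T = G F`.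
  have hPT : P.map (Prod.map (fun x => T *ᵥ x) id) = P := by
    conv_rhs => rw [hP, ← compProd_map_prodMap_of_ae_eq hmT hνT hae]
    rw [hP, Measure.map_map hTm (MeasurableEquiv.measurable _),
      Measure.map_map (MeasurableEquiv.measurable _) hTm]
    congr 1
    funext ⟨x, w⟩
    simp only [Function.comp_apply, channelEquiv_symm_apply, Prod.map_apply, id_eq,
      Matrix.mulVec_mulVec, hT4]
  set R := ν.prod (stdComplexGaussianVec q) with hR
  have hRT : R.map (Prod.map (fun x => T *ᵥ x) id) = R := by
    rw [hR, ← Measure.map_prod_map _ _ hmT measurable_id, hνT, Measure.map_id]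
  have hBm := measurable_mulVec B
  have hB'm : Measurable (fun x => -(B *ᵥ x)) := hBm.neg
  have hsh : ∀ f : (Fin N → ℂ) → Fin q → ℂ, Measurable f →
      Measurable (fun p : (Fin N → ℂ) × (Fin q → ℂ) => (p.1, p.2 + f p.1)) := fun f hf =>
    measurable_fst.prodMk (measurable_snd.add (hf.comp measurable_fst))
  -- `B T = -B` flips the shear, while `T` preserves the product law.
  have hQT : (R.tilted (fun p => shiftExponent (B *ᵥ p.1) p.2)).map
      (Prod.map (fun x => T *ᵥ x) id) =
      R.tilted (fun p => shiftExponent (-(B *ᵥ p.1)) p.2) := by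
    rw [hR, ← prod_stdComplexGaussianVec_map_shear ν hBm,
      ← prod_stdComplexGaussianVec_map_shear ν hB'm, ← hR, Measure.map_map hTm (hsh _ hBm)]
    conv_rhs => rw [← hRT, Measure.map_map (hsh _ hB'm) hTm]
    congr 1
    funext ⟨x, w⟩
    simp only [Function.comp_apply, Prod.map_apply, id_eq, hBT, neg_neg]
  have h1 := integral_exp_shiftExponent_prod (k := q) ν hBm
  have h1' := integral_exp_shiftExponent_prod (k := q) ν hB'm
  have := isProbabilityMeasure_tilted_of_integral_eq_one h1
  -- Data processing under `T`, which fixes `P` and swaps the tilts; this one inequality suffices.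
  have hle : klDiv P (R.tilted (fun p => shiftExponent (-(B *ᵥ p.1)) p.2)) ≤
      klDiv P (R.tilted (fun p => shiftExponent (B *ᵥ p.1) p.2)) := by
    have := klDiv_map_le P (R.tilted (fun p => shiftExponent (B *ᵥ p.1) p.2)) hTm
    rwa [hPT, hQT] at this
  have hcov := hasCovariance_complexGaussian hK
  rw [← hν] at hcov
  -- The terms linear in `w` cancel, so the sum depends on `x` alone and no moment of the attack's
  -- output is needed.
  have hsum : ∀ p : (Fin N → ℂ) × (Fin q → ℂ), shiftExponent (B *ᵥ p.1) p.2 +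
      shiftExponent (-(B *ᵥ p.1)) p.2 = -2 * (star (B *ᵥ p.1) ⬝ᵥ B *ᵥ p.1).re := fun p => by
    simp only [shiftExponent, star_neg, neg_dotProduct, dotProduct_neg, Complex.neg_re, neg_neg]
    ring
  have hfst : P.map Prod.fst = ν := by
    rw [hP, Measure.map_map measurable_fst (MeasurableEquiv.measurable _)]
    exact Measure.fst_compProd ν τ
  have hi := hcov.integrable_dotProduct_mulVec B
  have he := hcov.integral_dotProduct_mulVec B
  have hBs : ∀ ρ : Measure (Fin N → ℂ),
      AEStronglyMeasurable (fun x => (star (B *ᵥ x) ⬝ᵥ B *ᵥ x).re) ρ := fun ρ => by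
    refine Measurable.aestronglyMeasurable ?_
    simp only [Matrix.mulVec, dotProduct]
    fun_prop
  rw [← hfst, integrable_map_measure (hBs _) measurable_fst.aemeasurable] at hi
  rw [← hfst, integral_map measurable_fst.aemeasurable (hBs _)] at he
  have hmain := ofReal_le_klDiv_tilted_add_klDiv_tilted (P := P) h1 h1' (by
    simp only [hsum]
    exact hi.const_mul (-2))
  simp only [hsum] at hmain
  rw [integral_const_mul, he, neg_mul, neg_neg, ENNReal.ofReal_mul (by norm_num)] at hmain
  rw [payoff_eq_klDiv_tilted hσB κ (G * F)]
  have h2 : ENNReal.ofReal 2 * ENNReal.ofReal (B * K * Bᴴ).trace.re ≤ ENNReal.ofReal 2 *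
      klDiv P (R.tilted (fun p => shiftExponent (B *ᵥ p.1) p.2)) := by
    refine hmain.trans ((add_le_add_right hle _).trans ?_)
    rw [ENNReal.ofReal_ofNat, two_mul]
  exact (ENNReal.mul_le_mul_iff_right (by norm_num) (by norm_num)).mp h2

/-! ### Attaining the bound and assembling the theorem. -/

theorem isMarkovKernel_of_mem_attacks {κ : Kernel (Fin r → ℂ) (Fin q → ℂ)}
    (hκ : κ ∈ attacks r q σV) : IsMarkovKernel κ := by
  obtain ⟨η, hη, h⟩ := hκ
  exact ⟨fun z => by rw [h z]; infer_instance⟩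

theorem posSemidef_mul_conjTranspose_add_whiteCov (C : Matrix (Fin q) (Fin q) ℂ) (σV : ℝ) :
    (C * Cᴴ + whiteCov q σV).PosSemidef :=
  (Matrix.posSemidef_self_mul_conjTranspose C).add (posSemidef_whiteCov q σV)

theorem gaussianAttack_mem_attacks (σV : ℝ) (G : Matrix (Fin q) (Fin r) ℂ)
    (C : Matrix (Fin q) (Fin q) ℂ) : gaussianAttack σV G C ∈ attacks r q σV := by
  refine ⟨linearGaussianKernel G (C * Cᴴ), inferInstance, fun z => ?_⟩
  have h := complexGaussian_conv (G *ᵥ z) 0 (Matrix.posSemidef_self_mul_conjTranspose C)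
    (posSemidef_whiteCov q σV)
  rw [add_zero] at h
  exact h.symm

/-- The optimal attack reproduces the noise of the legitimate channel. -/
theorem payoff_gaussianAttack_Gstar (hσB : 0 < σB) (hK : K.PosSemidef)
    {C : Matrix (Fin q) (Fin q) ℂ} (hC : C * Cᴴ = CstarCov A F K σB σE σV) :
    payoff A F σB σE (complexGaussian 0 K) (gaussianAttack σV (Gstar A F K) C) =
      ENNReal.ofReal (((σB : ℂ)⁻¹ • (A - Gstar A F K * F)) * K *
        ((σB : ℂ)⁻¹ • (A - Gstar A F K * F))ᴴ).trace.re := by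
  have hKh : Kᴴ = K := hK.isHermitian
  have hJh := conjTranspose_pinv (conjTranspose_mul_mul (F := F) hKh)
  -- As `pinv (F * K * Fᴴ)` is Hermitian, `G⋆ G⋆ᴴ` contains its square, and the subtracted terms of
  -- `CstarCov` are restored exactly. The remaining noise divergence is that of a law from itself.
  have hS : Gstar A F K * whiteCov r σE * (Gstar A F K)ᴴ + (C * Cᴴ + whiteCov q σV) =
      whiteCov q σB := by
    have h1 : Gstar A F K * whiteCov r σE * (Gstar A F K)ᴴ = ((σE ^ 2 : ℝ) : ℂ) •
        (A * K * Fᴴ * pinv (F * K * Fᴴ) ^ 2 * (F * K * Aᴴ)) := by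
      rw [Gstar, whiteCov]
      simp only [Matrix.conjTranspose_mul, Matrix.conjTranspose_conjTranspose, hJh, hKh]
      simp only [Matrix.mul_smul, Matrix.smul_mul, Matrix.mul_one, Matrix.mul_assoc, sq]
    rw [h1, hC, CstarCov]
    abel
  have h0 : (σB : ℂ) ≠ 0 := by exact_mod_cast hσB.ne'
  rw [gaussianAttack, payoff_linearGaussianKernel hσB (hasCovariance_complexGaussian hK) hK _
    (posSemidef_mul_conjTranspose_add_whiteCov C σV), hS, sqrt_whiteCov q hσB.le, smul_smul,
    inv_mul_cancel₀ h0, one_smul]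
  simp only [Matrix.one_mulVec, Measure.map_id', klDiv_self, zero_add]

theorem isOptimalAttack_gaussianAttack_Gstar (hσB : 0 < σB) (hK : K.PosSemidef)
    {C : Matrix (Fin q) (Fin q) ℂ} (hC : C * Cᴴ = CstarCov A F K σB σE σV) :
    IsOptimalAttack A F σB σE σV (complexGaussian 0 K) (gaussianAttack σV (Gstar A F K) C) := by
  refine ⟨gaussianAttack_mem_attacks σV _ C, fun κ hκ => ?_⟩
  have := isMarkovKernel_of_mem_attacks hκ
  rw [payoff_gaussianAttack_Gstar hσB hK hC]
  exact ofReal_trace_le_payoff hσB hK κ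

theorem payoff_eq_of_mem_classC (hσB : 0 < σB) (hμ : HasCovariance μ K) (hK : K.PosSemidef)
    {κ : Kernel (Fin r → ℂ) (Fin q → ℂ)} (hκ : κ ∈ classC r q σV) :
    payoff A F σB σE μ κ = payoff A F σB σE (complexGaussian 0 K) κ := by
  obtain ⟨G, C, rfl⟩ := hκ
  have hS := posSemidef_mul_conjTranspose_add_whiteCov C σV
  rw [gaussianAttack, payoff_linearGaussianKernel hσB hμ hK G hS,
    payoff_linearGaussianKernel hσB (hasCovariance_complexGaussian hK) hK G hS]

end Spoofing

theorem mainTheorem4 {N r q : ℕ}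
    (A : Matrix (Fin q) (Fin N) ℂ) (F : Matrix (Fin r) (Fin N) ℂ)
    (σB σE σV : ℝ) (hσB : 0 < σB) (hσE : 0 ≤ σE) (hσV : 0 ≤ σV)
    (K : Matrix (Fin N) (Fin N) ℂ) (hK : K.PosSemidef)
    (px : Measure (Fin N → ℂ)) [IsProbabilityMeasure px] (hpx : Spoofing.HasCovariance px K) :
    (∀ κ ∈ Spoofing.classC r q σV,
      Spoofing.payoff A F σB σE px κ =
        Spoofing.payoff A F σB σE (Spoofing.complexGaussian 0 K) κ) ∧
    ∀ Cstar : Matrix (Fin q) (Fin q) ℂ,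
      Cstar * Cstarᴴ = Spoofing.CstarCov A F K σB σE σV →
      Spoofing.IsOptimalAttack A F σB σE σV (Spoofing.complexGaussian 0 K)
        (Spoofing.gaussianAttack σV (Spoofing.Gstar A F K) Cstar) ∧
      ∀ po : Kernel (Fin r → ℂ) (Fin q → ℂ), Spoofing.IsOptimalAttack A F σB σE σV px po →
        Spoofing.payoff A F σB σE px po ≤
          Spoofing.payoff A F σB σE px
            (Spoofing.gaussianAttack σV (Spoofing.Gstar A F K) Cstar) ∧
        Spoofing.payoff A F σB σE px
            (Spoofing.gaussianAttack σV (Spoofing.Gstar A F K) Cstar) =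
          Spoofing.payoff A F σB σE (Spoofing.complexGaussian 0 K)
            (Spoofing.gaussianAttack σV (Spoofing.Gstar A F K) Cstar) ∧
        Spoofing.payoff A F σB σE (Spoofing.complexGaussian 0 K)
            (Spoofing.gaussianAttack σV (Spoofing.Gstar A F K) Cstar) ≤
          Spoofing.payoff A F σB σE (Spoofing.complexGaussian 0 K) po := by
  have heq : ∀ κ ∈ Spoofing.classC r q σV, Spoofing.payoff A F σB σE px κ =
      Spoofing.payoff A F σB σE (Spoofing.complexGaussian 0 K) κ := fun κ hκ =>
    Spoofing.payoff_eq_of_mem_classC hσB hpx hK hκ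
  refine ⟨heq, fun Cstar hC => ?_⟩
  have hopt := Spoofing.isOptimalAttack_gaussianAttack_Gstar hσB hK hC
  exact ⟨hopt, fun po hpo => ⟨hpo.2 _ hopt.1, heq _ ⟨_, _, rfl⟩, hopt.2 po hpo.1⟩⟩
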